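/- Let $\Omega$ be the set of (Lebesgue-a.e. equivalence classes of) real-valued functions $b\in L^1_{\rm loc}(\mathbb R)$, with the metric $d(b,b')=\sum_{j\in\mathbb Z}2^{-|j|}\min\{1,\int_j^{j+1}|b(x)-b'(x)|\,dx\}$ and its Borel $\sigma$-algebra $\mathcal B(\Omega)$, and let $(\theta_z b)(x)=b(x+z)$ for $z\in\mathbb R$. A *Gaussian RUMF* (Gaussian random unidirectionally constant magnetic field) is a probability measure $\mathbb P$ on $(\Omega,\mathcal B(\Omega))$ such that (i) $\mathbb P$ is $\mathbb R$-ergodic: $\mathbb P(\theta_z\Delta)=\mathbb P(\Delta)$ for all $z\in\mathbb R$ and $\Delta\in\mathcal B(\Omega)$, and $\mathbb P(\Delta)\in\{0,1\}$ for every $\Delta\in\mathcal B(\Omega)$ with $\theta_z\Delta=\Delta$ for all $z\in\mathbb R$; (ii) $\mathbb P$ has a finite and non-zero mean-value: for all $\ell>0$ and almost all $x\in\mathbb R$, the functional $b\mapsto\int_{x-\ell}^{x+\ell}b(y)\,dy$ is $\mathbb P$-integrable and $(2\ell)^{-1}\int_\Omega\mathbb P(db)\int_{x-\ell}^{x+\ell}b(y)\,dy\neq0$;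 (iii) there are a constant $\mu\in\mathbb R\setminus\{0\}$ and a (positive) symmetric Borel measure $\tilde c$ on $\mathbb R$ with $0<\tilde c(\mathbb R)<\infty$ and without atoms such that, with $c(x)=\int_{\mathbb R}e^{iqx}\,\tilde c(dq)$ (which is real-valued), for all real-valued $\eta\in C_0^\infty(\mathbb R)$ $$\int_\Omega\mathbb P(db)\,\exp\Big\{-i\int_{\mathbb R}\eta(x)b(x)\,dx\Big\}=\exp\Big\{-i\mu\int_{\mathbb R}\eta(x)\,dx-\tfrac12\int_{\mathbb R\times\mathbb R}\eta(x)\,c(x-y)\,\eta(y)\,dx\,dy\Big\}.$$ Let $\Omega_2=\{b\in\Omega: b\in L^2_{\rm loc}(\mathbb R)\}$ with the metric $d_2(b,b')=\sum_{j\in\mathbb Z}2^{-|j|}\min\{1,(\int_j^{j+1}|b(x)-b'(x)|^2\,dx)^{1/2}\}$, and put $$\operatorname{supp}_2\mathbb P=\{b\in\Omega_2:\ \mathbb P(\{b'\in\Omega_2: d_2(b,b')<\delta\})>0\ \text{for all }\delta>0\},$$ $$\operatorname{supp}\mathbb P=\{b\in\Omega:\ \mathbb P(\{b'\in\Omega: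 d(b,b')<\delta\})>0\ \text{for all }\delta>0\}.$$ **Proposition A.1 (Topological support of a Gaussian RUMF).** For any Gaussian RUMF $(\Omega,\mathcal B(\Omega),\mathbb P)$ one has $\Omega_2=\operatorname{supp}_2\mathbb P$, and this set is contained in $\operatorname{supp}\mathbb P$. -/

import Mathlib

open MeasureTheory
open scoped ContDiff

noncomputable section

namespace RUMF

/-- The set `Ω` of realisations: (Lebesgue-a.e. equivalence classes of) real-valued, locally
Lebesgue-integrable functions on the real line. -/
structure Omega : Type where
  /-- the underlying a.e.-equivalence class -/
  toAEEqFun : ℝ →ₘ[(volume : Measure ℝ)] ℝ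
  /-- local integrability -/
  locInt : LocallyIntegrable (fun x => toAEEqFun x) (volume : Measure ℝ)

instance : CoeFun Omega fun _ => ℝ → ℝ := ⟨fun b => b.toAEEqFun⟩

theorem Omega.ext_ae {b b' : Omega} (h : (b : ℝ → ℝ) =ᵐ[volume] b') : b = b' := by
  cases b
  cases b'
  congr 1
  exact AEEqFun.ext h

/-- The distance
`d(b, b') = ∑_{j ∈ ℤ} 2^{-|j|} min {1, ∫_j^{j+1} |b(x) - b'(x)| dx}`. -/
def dOne (b b' : Omega) : ℝ :=
  ∑' j : ℤ, (2 : ℝ)⁻¹ ^ j.natAbs * min 1 (∫ x in (j : ℝ)..((j : ℝ) + 1), |b x - b' x|)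

theorem summable_weight : Summable fun j : ℤ => (2 : ℝ)⁻¹ ^ j.natAbs := by
  refine Summable.of_nat_of_neg ?_ ?_ <;>
    simpa using summable_geometric_of_lt_one (r := (2 : ℝ)⁻¹) (by norm_num) (by norm_num)

theorem intervalIntegrable_abs_sub (b b' : Omega) (u v : ℝ) :
    IntervalIntegrable (fun x => |b x - b' x|) volume u v :=
  ((b.locInt.integrableOn_isCompact isCompact_uIcc).intervalIntegrable.sub
    (b'.locInt.integrableOn_isCompact isCompact_uIcc).intervalIntegrable).abs

theorem dOne_int_nonneg (b b' : Omega) (j : ℤ) :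
    0 ≤ ∫ x in (j : ℝ)..((j : ℝ) + 1), |b x - b' x| :=
  intervalIntegral.integral_nonneg (by linarith) fun _ _ => abs_nonneg _

theorem dOne_term_nonneg (b b' : Omega) (j : ℤ) :
    0 ≤ (2 : ℝ)⁻¹ ^ j.natAbs * min 1 (∫ x in (j : ℝ)..((j : ℝ) + 1), |b x - b' x|) :=
  mul_nonneg (by positivity) (le_min zero_le_one (dOne_int_nonneg b b' j))

theorem summable_dOne (b b' : Omega) : Summable fun j : ℤ =>
    (2 : ℝ)⁻¹ ^ j.natAbs * min 1 (∫ x in (j : ℝ)..((j : ℝ) + 1), |b x - b' x|) :=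
  Summable.of_nonneg_of_le (dOne_term_nonneg b b')
    (fun _ => mul_le_of_le_one_right (by positivity) (min_le_left _ _)) summable_weight

theorem dOne_self (b : Omega) : dOne b b = 0 := by simp [dOne]

theorem dOne_comm (b b' : Omega) : dOne b b' = dOne b' b := by
  simp only [dOne, abs_sub_comm]

theorem dOne_triangle (b b' b'' : Omega) : dOne b b'' ≤ dOne b b' + dOne b' b'' := by
  unfold dOne
  rw [← (summable_dOne b b').tsum_add (summable_dOne b' b'')]
  refine (summable_dOne b b'').tsum_le_tsum (fun j => ?_)
    ((summable_dOne b b').add (summable_dOne b' b''))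
  rw [← mul_add]
  refine mul_le_mul_of_nonneg_left ?_ (by positivity)
  have h : (∫ x in (j : ℝ)..((j : ℝ) + 1), |b x - b'' x|) ≤
      (∫ x in (j : ℝ)..((j : ℝ) + 1), |b x - b' x|) +
        ∫ x in (j : ℝ)..((j : ℝ) + 1), |b' x - b'' x| := by
    rw [← intervalIntegral.integral_add (intervalIntegrable_abs_sub _ _ _ _)
      (intervalIntegrable_abs_sub _ _ _ _)]
    exact intervalIntegral.integral_mono_on (by linarith) (intervalIntegrable_abs_sub _ _ _ _)
      ((intervalIntegrable_abs_sub _ _ _ _).add (intervalIntegrable_abs_sub _ _ _ _))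
      fun x _ => abs_sub_le _ _ _
  have h1 := dOne_int_nonneg b b' j
  have h2 := dOne_int_nonneg b' b'' j
  rcases min_cases 1 (∫ x in (j : ℝ)..((j : ℝ) + 1), |b x - b'' x|) with h3 | h3 <;>
  rcases min_cases 1 (∫ x in (j : ℝ)..((j : ℝ) + 1), |b x - b' x|) with h4 | h4 <;>
  rcases min_cases 1 (∫ x in (j : ℝ)..((j : ℝ) + 1), |b' x - b'' x|) with h5 | h5 <;>
  linarith

theorem eq_of_dOne_eq_zero {b b' : Omega} (h : dOne b b' = 0) : b = b' := by
  have hs := (summable_dOne b b').hasSum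
  change HasSum _ (dOne b b') at hs
  rw [h] at hs
  have h0 := (hasSum_zero_iff_of_nonneg (dOne_term_nonneg b b')).1 hs
  apply Omega.ext_ae
  have hj : ∀ j : ℤ, ∀ᵐ x ∂(volume : Measure ℝ),
      x ∈ Set.Ioc (j : ℝ) ((j : ℝ) + 1) → b x = b' x := by
    intro j
    have h1 := congrFun h0 j
    have h2 : (∫ x in (j : ℝ)..((j : ℝ) + 1), |b x - b' x|) = 0 := by
      rcases mul_eq_zero.1 h1 with h2 | h2
      · exact absurd h2 (by positivity)
      · rcases min_choice 1 (∫ x in (j : ℝ)..((j : ℝ) + 1), |b x - b' x|) with h3 | h3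
        · rw [h3] at h2
          norm_num at h2
        · rwa [h3] at h2
    rw [intervalIntegral.integral_of_le (by linarith)] at h2
    have h4 := (integral_eq_zero_iff_of_nonneg (fun x => abs_nonneg _)
      (intervalIntegrable_abs_sub b b' j (j + 1)).1).1 h2
    rw [Filter.EventuallyEq, ae_restrict_iff' measurableSet_Ioc] at h4
    filter_upwards [h4] with x hx hxm
    exact sub_eq_zero.1 (abs_eq_zero.1 (hx hxm))
  filter_upwards [ae_all_iff.2 hj] with x hx
  refine hx (⌈x⌉ - 1) ⟨?_, ?_⟩
  · push_cast
    linarith [Int.ceil_lt_add_one x]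
  · push_cast
    linarith [Int.le_ceil x]

instance : MetricSpace Omega where
  dist := dOne
  dist_self := dOne_self
  dist_comm := dOne_comm
  dist_triangle := dOne_triangle
  eq_of_dist_eq_zero := eq_of_dOne_eq_zero

/-- The events are the Borel sets of the metric space `(Ω, d)`. -/
instance : MeasurableSpace Omega := borel Omega

instance : BorelSpace Omega := ⟨rfl⟩

/-- The shift `(θ_z b)(x) = b(x + z)`. -/
def shift (z : ℝ) (b : Omega) : Omega where
  toAEEqFun := b.toAEEqFun.compMeasurePreserving (fun x => x + z)
    (measurePreserving_add_right volume z)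
  locInt := by
    rw [locallyIntegrable_iff]
    intro K hK
    have hK' : IsCompact ((fun x => x + z) '' K) := hK.image (by fun_prop)
    have h := (b.locInt.integrableOn_isCompact hK')
    have h1 := ((measurePreserving_add_right (volume : Measure ℝ) z).integrableOn_image
      (measurableEmbedding_addRight z)).1 h
    exact h1.congr (ae_restrict_of_ae (AEEqFun.coeFn_compMeasurePreserving b.toAEEqFun _).symm)

/-- The mean-value `(2ℓ)⁻¹ ∫ P(db) ∫_{x-ℓ}^{x+ℓ} b(y) dy`. -/
def meanValue (P : Measure Omega) (l x : ℝ) : ℝ :=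
  (2 * l)⁻¹ * ∫ b : Omega, (∫ y in (x - l)..(x + l), b y) ∂P

/-- A random unidirectionally constant magnetic field: a Borel probability measure on `Ω` which is
`ℝ`-ergodic (invariant under all shifts and trivial on shift-invariant events) and has a finite and
non-zero mean-value. -/
structure IsRUMF (P : Measure Omega) : Prop where
  isProbabilityMeasure : IsProbabilityMeasure P
  homogeneous : ∀ z : ℝ, ∀ D : Set Omega, MeasurableSet D → P (shift z '' D) = P D
  ergodic : ∀ D : Set Omega, MeasurableSet D → (∀ z : ℝ, shift z '' D = D) → P D = 0 ∨ P D = 1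
  mean_finite : ∀ l : ℝ, 0 < l → ∀ᵐ x : ℝ,
    Integrable (fun b : Omega => ∫ y in (x - l)..(x + l), b y) P
  mean_ne_zero : ∀ l : ℝ, 0 < l → ∀ᵐ x : ℝ, meanValue P l x ≠ 0

/-- The characteristic functional `η ↦ ∫ P(db) exp (-i ∫ η(x) b(x) dx)`. -/
def charFunctional (P : Measure Omega) (η : ℝ → ℝ) : ℂ :=
  ∫ b : Omega, Complex.exp (-Complex.I * ((∫ x, η x * b x : ℝ) : ℂ)) ∂P

/-- A Gaussian RUMF: a RUMF whose characteristic functional is the Gaussian one with a non-zero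
mean `m` and covariance function `c` the Fourier transform of a symmetric, finite, non-zero
spectral measure `ct` without atoms (no pure-point part). -/
def IsGaussianRUMF (P : Measure Omega) : Prop :=
  IsRUMF P ∧
  ∃ (m : ℝ) (c : ℝ → ℝ) (ct : Measure ℝ),
    m ≠ 0 ∧
    (∀ A : Set ℝ, MeasurableSet A → ct ((fun q => -q) ⁻¹' A) = ct A) ∧
    0 < ct Set.univ ∧ ct Set.univ < ⊤ ∧
    (∀ q : ℝ, ct {q} = 0) ∧
    (∀ x : ℝ, (c x : ℂ) = ∫ q : ℝ, Complex.exp (Complex.I * q * x) ∂ct) ∧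
    ∀ η : ℝ → ℝ, ContDiff ℝ ∞ η → HasCompactSupport η →
      charFunctional P η =
        Complex.exp (-Complex.I * m * ((∫ x, η x : ℝ) : ℂ)
          - 1 / 2 * ((∫ p : ℝ × ℝ, η p.1 * c (p.1 - p.2) * η p.2 : ℝ) : ℂ))

/-- `Ω₂`: the realisations which are locally square-integrable. -/
def OmegaTwo : Set Omega :=
  {b | ∀ K : Set ℝ, IsCompact K → MemLp b 2 (volume.restrict K)}

/-- The distance
`d₂(b, b') = ∑_{j ∈ ℤ} 2^{-|j|} min {1, (∫_j^{j+1} |b(x) - b'(x)|² dx)^{1/2}}`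
(used for `b, b' ∈ Ω₂`). -/
def dTwo (b b' : Omega) : ℝ :=
  ∑' j : ℤ, (2 : ℝ)⁻¹ ^ j.natAbs *
    min 1 (Real.sqrt (∫ x in (j : ℝ)..((j : ℝ) + 1), |b x - b' x| ^ 2))

/-- The `L¹_loc`-topological support of `P`, with balls in the metric `d`. -/
def suppOne (P : Measure Omega) : Set Omega :=
  {b | ∀ δ : ℝ, 0 < δ → 0 < P {b' | dOne b b' < δ}}

/-- The `L²_loc`-topological support of `P`, with balls in the metric `d₂` on `Ω₂`. -/
def suppTwo (P : Measure Omega) : Set Omega :=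
  {b | b ∈ OmegaTwo ∧ ∀ δ : ℝ, 0 < δ → 0 < P {b' | b' ∈ OmegaTwo ∧ dTwo b b' < δ}}

/-- `suppOne` is Mathlib's support of a measure, for the topology of `(Ω, d)`. -/
theorem suppOne_eq_support (P : Measure Omega) : suppOne P = P.support := by
  ext b
  rw [Metric.nhds_basis_ball.mem_measureSupport]
  refine forall₂_congr fun δ _ => ?_
  have : {b' | dOne b b' < δ} = Metric.ball b δ := by
    ext b'
    exact (Metric.mem_ball'.symm : dist b b' < δ ↔ _)
  rw [this]

end RUMF

end

/-!
The inclusion of `suppTwo P` in `OmegaTwo` is part of the definition, and `suppTwo P ⊆ suppOne P`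
because `d ≤ d₂` on `Ω₂` (`dOne_le_dTwo`). The substance is that every `d₂`-ball around a point of
`Ω₂` has positive probability.

Proximity in `d₂` follows from proximity in `L²(-R, R)` for a large `R` (`exists_dTwo_lt`), so one
studies the law of the field restricted to `(-R, R)`.

* The restriction is almost surely square-integrable: the covariance function is bounded, so
  mollified fields have uniformly bounded second moments, and these pass to the limit
  (`ae_memLp_two_restrict_Ioo`).
* Its law on `L²(-R, R)` is a Gaussian measure whose covariance form is the spectral form
  `h ↦ ∫ |ĥ(q)|² c̃(dq)`: this is the hypothesis for smooth test functions, and both sides are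
  continuous in `h` (`charFun_map_toWindow`, `isGaussian_map_toWindow`).
* The support of a centred Gaussian measure is a closed linear subspace, by rotation invariance of
  the product of two copies (`cos_smul_add_sin_smul_mem_support`). Hence the support is everything
  as soon as no non-trivial functional has zero variance (`support_eq_univ_of_variance_ne_zero`).
* The spectral form is non-degenerate: if it vanishes at `h`, then `ĥ` vanishes `c̃`-almost
  everywhere. As `h` has bounded support, `ĥ` is entire, and since `c̃` is non-zero without atoms
  the zeros of `ĥ` accumulate, so that `ĥ = 0` and `h = 0`
  (`ext_of_charFun_ae_eq`, `spectralForm_ne_zero`).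
-/

/-! ### Supports of Gaussian measures -/

section GaussianSupport

open ProbabilityTheory Topology

variable {E : Type*} [NormedAddCommGroup E] [InnerProductSpace ℝ E] [CompleteSpace E]
  [SecondCountableTopology E] [MeasurableSpace E] [BorelSpace E]

/-- The support of a centred Gaussian measure is stable under plane rotations, because the product
of two copies of the measure is rotation invariant. -/
theorem cos_smul_add_sin_smul_mem_support (ν : Measure E) [IsGaussian ν] (hν : ν[id] = 0)
    {x y : E} (hx : x ∈ ν.support) (hy : y ∈ ν.support) (θ : ℝ) :
    Real.cos θ • x + Real.sin θ • y ∈ ν.support := by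
  rw [Measure.mem_support_iff_forall] at hx hy ⊢
  intro U hU
  have hcont : Continuous fun p : E × E => Real.cos θ • p.1 + Real.sin θ • p.2 := by fun_prop
  have hpre := hcont.continuousAt.preimage_mem_nhds (x := (x, y)) hU
  rw [mem_nhds_prod_iff] at hpre
  obtain ⟨V, hV, W, hW, hVW⟩ := hpre
  have hmeas : Measurable (ContinuousLinearMap.rotation (E := E) θ) := by fun_prop
  calc 0 < ν V * ν W := ENNReal.mul_pos (hx V hV).ne' (hy W hW).ne'
    _ = (ν.prod ν) (V ×ˢ W) := (Measure.prod_prod V W).symm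
    _ ≤ (ν.prod ν) (ContinuousLinearMap.rotation θ ⁻¹' (U ×ˢ Set.univ)) := by
      refine measure_mono fun p hp => ⟨?_, trivial⟩
      exact hVW hp
    _ ≤ ((ν.prod ν).map (ContinuousLinearMap.rotation θ)) (U ×ˢ Set.univ) :=
      Measure.le_map_apply hmeas.aemeasurable _
    _ = ν U := by
      rw [IsGaussian.map_rotation_eq_self hν, Measure.prod_prod, measure_univ, mul_one]

/-- The support of a centred Gaussian measure, as a linear subspace. -/
noncomputable def gaussianSupport (ν : Measure E) [IsGaussian ν] (hν : ν[id] = 0) :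
    Submodule ℝ E :=
  have rot {x y : E} (hx : x ∈ ν.support) (hy : y ∈ ν.support) (θ : ℝ) :=
    cos_smul_add_sin_smul_mem_support ν hν hx hy θ
  have hsq : √2 * (√2 / 2) = 1 := by
    rw [← mul_div_assoc, Real.mul_self_sqrt (by norm_num)]; norm_num
  have zero_mem : (0 : E) ∈ ν.support := by
    obtain ⟨x, hx⟩ := Measure.nonempty_support (μ := ν) (IsProbabilityMeasure.ne_zero ν)
    have h := rot hx hx (-(Real.pi / 4))
    simpa [Real.cos_neg, Real.sin_neg] using h
  have sqrt_two_smul {x : E} (hx : x ∈ ν.support) : √2 • x ∈ ν.support := by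
    have h := rot hx hx (Real.pi / 4)
    rw [Real.cos_pi_div_four, Real.sin_pi_div_four, ← add_smul, add_halves] at h
    exact h
  have contract {x : E} (hx : x ∈ ν.support) {c : ℝ} (hc : |c| ≤ 1) : c • x ∈ ν.support := by
    have h := rot hx zero_mem (Real.arccos c)
    rwa [Real.cos_arccos (abs_le.1 hc).1 (abs_le.1 hc).2, smul_zero, add_zero] at h
  { carrier := ν.support
    zero_mem' := zero_mem
    add_mem' := by
      intro x y hx hy
      have h := rot (sqrt_two_smul hx) (sqrt_two_smul hy) (Real.pi / 4)
      rwa [Real.cos_pi_div_four, Real.sin_pi_div_four, smul_smul, smul_smul, mul_comm, hsq,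
        one_smul, one_smul] at h
    smul_mem' := by
      intro c x hx
      -- Scale up by a power of `√2` exceeding `|c|`, then contract.
      have hpow : ∀ k : ℕ, √2 ^ k • x ∈ ν.support := by
        intro k
        induction k with
        | zero => simpa using hx
        | succ k ih => rw [pow_succ', mul_smul]; exact sqrt_two_smul ih
      obtain ⟨k, hk⟩ := pow_unbounded_of_one_lt |c| (Real.lt_sqrt_of_sq_lt (by norm_num) :
        (1 : ℝ) < √2)
      have hpos : 0 < √2 ^ k := by positivity
      have h := contract (hpow k) (c := c / √2 ^ k) (by
        rw [abs_div, abs_of_pos hpos, div_le_one hpos]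
        exact hk.le)
      rwa [smul_smul, div_mul_cancel₀ _ hpos.ne'] at h }

theorem coe_gaussianSupport (ν : Measure E) [IsGaussian ν] (hν : ν[id] = 0) :
    (gaussianSupport ν hν : Set E) = ν.support := rfl

/-- A Gaussian measure on a separable Hilbert space, none of whose non-trivial linear functionals is
almost surely constant, charges every non-empty open set: the support of the centred measure is a
closed subspace, and a vector orthogonal to it is a degenerate direction. -/
theorem support_eq_univ_of_variance_ne_zero (ν : Measure E) [IsGaussian ν]
    (hvar : ∀ h : E, h ≠ 0 → Var[fun x => inner ℝ h x; ν] ≠ 0) : ν.support = Set.univ := by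
  set a : E := ∫ x, x ∂ν with ha
  set ν₀ : Measure E := ν.map (fun x => x - a) with hν₀
  have hm : Measurable fun x : E => x - a := by fun_prop
  have hG : IsGaussian ν₀ := by rw [hν₀]; infer_instance
  have hmean : ν₀[id] = 0 := by
    rw [hν₀, integral_map hm.aemeasurable (by fun_prop)]
    have hi : Integrable (fun x : E => x) ν := IsGaussian.integrable_id
    simp only [id]
    rw [integral_sub hi (integrable_const a), integral_const]
    simp [ha]
  have hae : ∀ᵐ x ∂ν, x - a ∈ ν₀.support := ae_of_ae_map hm.aemeasurable Measure.support_mem_ae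
  have horth : (gaussianSupport ν₀ hmean)ᗮ = ⊥ := by
    rw [eq_bot_iff]
    intro h hh
    by_contra hne
    refine hvar h hne ?_
    have hconst : (fun x => inner ℝ h x) =ᵐ[ν] fun _ => inner ℝ h a := by
      filter_upwards [hae] with x hx
      have h0 : inner ℝ (x - a) h = 0 := (Submodule.mem_orthogonal _ _).1 hh _ hx
      rw [real_inner_comm, inner_sub_right, sub_eq_zero] at h0
      exact h0
    rw [variance_congr hconst, variance_eq_integral (by fun_prop)]
    simp
  have htop : ν₀.support = Set.univ := by
    have h1 := (Submodule.topologicalClosure_eq_top_iff (K := gaussianSupport ν₀ hmean)).2 horth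
    have hcl : IsClosed (gaussianSupport ν₀ hmean : Set E) := Measure.isClosed_support
    rw [hcl.submodule_topologicalClosure_eq] at h1
    rw [← coe_gaussianSupport ν₀ hmean, h1]
    rfl
  refine Set.eq_univ_of_forall fun x => ?_
  rw [Metric.nhds_basis_ball.mem_measureSupport]
  intro r hr
  have hx : x - a ∈ ν₀.support := htop ▸ Set.mem_univ _
  rw [Metric.nhds_basis_ball.mem_measureSupport] at hx
  have h := hx r hr
  rw [hν₀, Measure.map_apply hm measurableSet_ball] at h
  refine h.trans_le (measure_mono fun y hy => ?_)
  simpa [Metric.mem_ball, dist_eq_norm] using hy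

end GaussianSupport

/-! ### Uniqueness from characteristic functions on a non-atomic set -/

section CharFunUniqueness

open ProbabilityTheory Topology Filter

/-- Two measures with all exponential moments agree as soon as their characteristic functions agree
almost everywhere with respect to some non-zero measure without atoms: the characteristic functions
extend to entire functions, and every set of positive measure has an accumulation point. -/
theorem ext_of_charFun_ae_eq {μ₁ μ₂ ct : Measure ℝ} [IsFiniteMeasure μ₁] [IsFiniteMeasure μ₂]
    (h₁ : integrableExpSet id μ₁ = Set.univ) (h₂ : integrableExpSet id μ₂ = Set.univ)
    (hatom : ∀ q : ℝ, ct {q} = 0) (hpos : 0 < ct Set.univ)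
    (h : ∀ᵐ q ∂ct, charFun μ₁ q = charFun μ₂ q) : μ₁ = μ₂ := by
  have ha₁ : AnalyticOnNhd ℂ (complexMGF id μ₁) Set.univ := fun z _ =>
    analyticAt_complexMGF (by simp [h₁])
  have ha₂ : AnalyticOnNhd ℂ (complexMGF id μ₂) Set.univ := fun z _ =>
    analyticAt_complexMGF (by simp [h₂])
  refine Measure.ext_of_complexMGF_id_eq ?_
  by_contra hne
  have hnull : ct {q | charFun μ₁ q = charFun μ₂ q} = 0 := by
    refine measure_null_of_locally_null _ fun q _ => ?_
    have hev : ∀ᶠ z in 𝓝[≠] ((q : ℂ) * Complex.I), complexMGF id μ₁ z ≠ complexMGF id μ₂ z := by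
      by_contra hf
      exact hne (ha₁.eq_of_frequently_eq ha₂ hf)
    have hcont : Tendsto (fun t : ℝ => (t : ℂ) * Complex.I) (𝓝[≠] q)
        (𝓝[≠] ((q : ℂ) * Complex.I)) := by
      refine tendsto_nhdsWithin_iff.2 ⟨?_, ?_⟩
      · exact (Continuous.tendsto (by fun_prop) q).mono_left nhdsWithin_le_nhds
      · filter_upwards [self_mem_nhdsWithin] with t ht
        simpa using ht
    have hev' := hcont.eventually hev
    simp only [complexMGF_id_mul_I] at hev'
    refine ⟨{q}, ?_, hatom q⟩
    rw [eventually_nhdsWithin_iff] at hev'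
    rw [mem_nhdsWithin_iff_eventually]
    filter_upwards [hev'] with t ht htA
    by_contra htq
    exact ht htq htA
  exact hpos.ne' (by
    rw [← Set.union_compl_self {q | charFun μ₁ q = charFun μ₂ q}]
    exact measure_union_null hnull h)

theorem integrableExpSet_withDensity_restrict_Ioo (R : ℝ) (g : ℝ → NNReal)
    (hg : Measurable g)
    (hgi : Integrable (fun x => (g x : ℝ)) (volume.restrict (Set.Ioo (-R) R))) :
    integrableExpSet id ((volume.restrict (Set.Ioo (-R) R)).withDensity fun x => (g x : ENNReal)) =
      Set.univ := by
  refine Set.eq_univ_of_forall fun t => ?_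
  change Integrable (fun x : ℝ => Real.exp (t * id x)) _
  rw [integrable_withDensity_iff_integrable_smul hg]
  simp only [NNReal.smul_def, smul_eq_mul]
  refine hgi.mul_bdd (c := Real.exp (|t| * |R|)) (by fun_prop) ?_
  filter_upwards [ae_restrict_mem measurableSet_Ioo] with x hx
  rw [Real.norm_eq_abs, Real.abs_exp]
  refine Real.exp_le_exp.2 ((le_abs_self _).trans ?_)
  rw [abs_mul]
  refine mul_le_mul_of_nonneg_left ?_ (abs_nonneg _)
  exact (abs_le.2 ⟨hx.1.le, hx.2.le⟩ : |x| ≤ R).trans (le_abs_self R)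

/-- An integrable function on a bounded interval whose cosine and sine transforms vanish almost
everywhere with respect to some non-zero measure without atoms is zero. -/
theorem ae_eq_zero_of_cos_sin_integral_eq_zero (R : ℝ) {ct : Measure ℝ}
    (hatom : ∀ q : ℝ, ct {q} = 0) (hpos : 0 < ct Set.univ) {h : ℝ → ℝ}
    (hm : Measurable h) (hi : Integrable h (volume.restrict (Set.Ioo (-R) R)))
    (h0 : ∀ᵐ q ∂ct, ∫ x in Set.Ioo (-R) R, Real.cos (q * x) * h x = 0 ∧
      ∫ x in Set.Ioo (-R) R, Real.sin (q * x) * h x = 0) :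
    h =ᵐ[volume.restrict (Set.Ioo (-R) R)] 0 := by
  set μ := (volume : Measure ℝ).restrict (Set.Ioo (-R) R) with hμ
  -- The positive and negative parts of `h`, as densities, have `ct`-almost everywhere the
  -- same characteristic function.
  have hip : Integrable (fun x => ((h x).toNNReal : ℝ)) μ := by
    simpa [Real.coe_toNNReal'] using hi.pos_part
  have hin : Integrable (fun x => ((-h x).toNNReal : ℝ)) μ := by
    simpa [Real.coe_toNNReal'] using hi.neg_part
  have hmp : Measurable fun x => (h x).toNNReal := by fun_prop
  have hmn : Measurable fun x => (-h x).toNNReal := by fun_prop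
  have hfp : ∫⁻ x, ((h x).toNNReal : ENNReal) ∂μ ≠ ⊤ := by
    simpa only [ENNReal.ofReal_coe_nnreal] using hip.lintegral_lt_top.ne
  have hfn : ∫⁻ x, ((-h x).toNNReal : ENNReal) ∂μ ≠ ⊤ := by
    simpa only [ENNReal.ofReal_coe_nnreal] using hin.lintegral_lt_top.ne
  have : IsFiniteMeasure (μ.withDensity fun x => ((h x).toNNReal : ENNReal)) :=
    isFiniteMeasure_withDensity hfp
  have : IsFiniteMeasure (μ.withDensity fun x => ((-h x).toNNReal : ENNReal)) :=
    isFiniteMeasure_withDensity hfn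
  have key : (μ.withDensity fun x => ((h x).toNNReal : ENNReal)) =
      μ.withDensity fun x => ((-h x).toNNReal : ENNReal) := by
    refine ext_of_charFun_ae_eq (ct := ct)
      (integrableExpSet_withDensity_restrict_Ioo R _ hmp hip)
      (integrableExpSet_withDensity_restrict_Ioo R _ hmn hin) hatom hpos ?_
    filter_upwards [h0] with q hq
    rw [charFun_apply_real, charFun_apply_real, integral_withDensity_eq_integral_smul hmp,
      integral_withDensity_eq_integral_smul hmn, ← sub_eq_zero]
    have hexp : ∀ g : ℝ → NNReal, Integrable (fun x => (g x : ℝ)) μ →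
        Integrable (fun x => g x • Complex.exp (q * x * Complex.I)) μ := by
      intro g hg
      have := hg.ofReal (𝕜 := ℂ) |>.mul_bdd (c := 1)
        (g := fun x : ℝ => Complex.exp (q * x * Complex.I)) (by fun_prop)
        (ae_of_all _ fun x => by
          rw [← Complex.ofReal_mul, Complex.norm_exp_ofReal_mul_I])
      refine this.congr (ae_of_all _ fun x => ?_)
      simp [NNReal.smul_def]
    rw [← integral_sub (hexp _ hip) (hexp _ hin)]
    have hcos : Integrable (fun x => Real.cos (q * x) * h x) μ :=
      hi.bdd_mul (c := 1) (by fun_prop) (ae_of_all _ fun x => Real.abs_cos_le_one _)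
    have hsin : Integrable (fun x => Real.sin (q * x) * h x) μ :=
      hi.bdd_mul (c := 1) (by fun_prop) (ae_of_all _ fun x => Real.abs_sin_le_one _)
    have hpt : ∀ x : ℝ, (h x).toNNReal • Complex.exp (q * x * Complex.I) -
        (-h x).toNNReal • Complex.exp (q * x * Complex.I) =
        ((Real.cos (q * x) * h x : ℝ) : ℂ) + ((Real.sin (q * x) * h x : ℝ) : ℂ) * Complex.I := by
      intro x
      have hx : (((h x).toNNReal : ℝ) : ℂ) - (((-h x).toNNReal : ℝ) : ℂ) = h x := by
        rw [← Complex.ofReal_sub, Real.coe_toNNReal', Real.coe_toNNReal',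
          max_zero_sub_max_neg_zero_eq_self]
      simp only [NNReal.smul_def, Complex.real_smul]
      rw [← sub_mul, hx, Complex.exp_mul_I]
      push_cast
      ring
    simp only [hpt]
    rw [integral_add hcos.ofReal (hsin.ofReal.mul_const _), integral_mul_const,
      integral_complex_ofReal, integral_complex_ofReal, hq.1, hq.2]
    simp
  rw [withDensity_eq_iff (by fun_prop) (by fun_prop) hfp] at key
  filter_upwards [key] with x hx
  have hx' : (h x).toNNReal = (-h x).toNNReal := by exact_mod_cast hx
  rw [Pi.zero_apply, ← max_zero_sub_max_neg_zero_eq_self (h x), ← Real.coe_toNNReal',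
    ← Real.coe_toNNReal', hx', sub_self]

end CharFunUniqueness

namespace RUMF

/-! ### Linear functionals of the field -/

section LinearFunctionals

open Topology Filter

theorem tendsto_integral_abs_sub (b : Omega) (j : ℤ) :
    Tendsto (fun b' : Omega => ∫ x in (j : ℝ)..((j : ℝ) + 1), |b' x - b x|) (𝓝 b) (𝓝 0) := by
  rw [Metric.tendsto_nhds]
  intro ε hε
  have hw : (0 : ℝ) < (2 : ℝ)⁻¹ ^ j.natAbs := by positivity
  have hδ : 0 < (2 : ℝ)⁻¹ ^ j.natAbs * min 1 ε := mul_pos hw (lt_min one_pos hε)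
  filter_upwards [Metric.ball_mem_nhds b hδ] with b' hb'
  have hlt : dOne b' b < (2 : ℝ)⁻¹ ^ j.natAbs * min 1 ε := hb'
  have hle := (summable_dOne b' b).le_tsum j fun i _ => dOne_term_nonneg b' b i
  have h := lt_of_mul_lt_mul_left (hle.trans_lt hlt) hw.le
  have hnn := dOne_int_nonneg b' b j
  rw [Real.dist_eq, sub_zero, abs_of_nonneg hnn]
  rcases min_lt_iff.1 h with h | h
  · exact absurd (h.trans_le (min_le_left _ _)) (lt_irrefl _)
  · exact h.trans_le (min_le_right _ _)

theorem tendsto_integral_abs_sub_neg_nat (b : Omega) (N : ℕ) :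
    Tendsto (fun b' : Omega => ∫ x in (-N : ℝ)..N, |b' x - b x|) (𝓝 b) (𝓝 0) := by
  have hsum : ∀ b' : Omega, ∫ x in (-N : ℝ)..N, |b' x - b x| =
      ∑ k ∈ Finset.range (2 * N),
        ∫ x in (((k : ℤ) - N : ℤ) : ℝ)..((((k : ℤ) - N : ℤ) : ℝ) + 1), |b' x - b x| := by
    intro b'
    have h := intervalIntegral.sum_integral_adjacent_intervals (μ := volume)
      (f := fun x => |b' x - b x|) (a := fun k : ℕ => (k : ℝ) - N) (n := 2 * N)
      fun k _ => intervalIntegrable_abs_sub b' b _ _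
    push_cast at h ⊢
    rw [show (2 * (N : ℝ) - N) = N by ring, show (0 : ℝ) - N = -N by ring] at h
    rw [← h]
    refine Finset.sum_congr rfl fun k _ => ?_
    rw [show (k : ℝ) + 1 - N = k - N + 1 by ring]
  simp only [hsum]
  rw [← Finset.sum_const_zero (s := Finset.range (2 * N))]
  exact tendsto_finsetSum _ fun k _ => tendsto_integral_abs_sub b _

theorem integrable_mul_omega {η : ℝ → ℝ} (hη : Continuous η) (hc : HasCompactSupport η)
    (b : Omega) : Integrable fun x => η x * b x :=
  b.locInt.integrable_smul_left_of_hasCompactSupport hη hc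

theorem continuous_integral_mul {η : ℝ → ℝ} (hη : Continuous η) (hc : HasCompactSupport η) :
    Continuous fun b : Omega => ∫ x, η x * b x := by
  obtain ⟨M, hM⟩ := hη.bounded_above_of_compact_support hc
  obtain ⟨r, hr⟩ := hc.isCompact.isBounded.subset_closedBall 0
  obtain ⟨N, hN⟩ := exists_nat_ge r
  have hzero : ∀ x, x ∉ Set.Ioc (-(N + 1 : ℕ) : ℝ) (N + 1 : ℕ) → η x = 0 := by
    intro x hx
    by_contra hne
    have h1 := hr (subset_tsupport η hne)
    rw [Metric.mem_closedBall, Real.dist_eq, sub_zero, abs_le] at h1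
    refine hx ⟨?_, ?_⟩ <;> push_cast <;> linarith
  rw [continuous_iff_continuousAt]
  intro b
  rw [ContinuousAt, tendsto_iff_norm_sub_tendsto_zero]
  have hlim := (tendsto_integral_abs_sub_neg_nat b (N + 1)).const_mul M
  rw [mul_zero] at hlim
  refine squeeze_zero (fun _ => norm_nonneg _) (fun b' => ?_) hlim
  rw [← integral_sub (integrable_mul_omega hη hc b') (integrable_mul_omega hη hc b)]
  have hneg : (-(N + 1 : ℕ) : ℝ) ≤ (N + 1 : ℕ) := by push_cast; linarith
  have hint := intervalIntegrable_abs_sub b' b (-(N + 1 : ℕ) : ℝ) (N + 1 : ℕ)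
  rw [intervalIntegrable_iff_integrableOn_Ioc_of_le hneg] at hint
  rw [← setIntegral_eq_integral_of_forall_compl_eq_zero
      (s := Set.Ioc (-(N + 1 : ℕ) : ℝ) (N + 1 : ℕ)) fun x hx => by simp [hzero x hx],
    intervalIntegral.integral_of_le hneg, ← integral_const_mul]
  refine norm_integral_le_of_norm_le (hint.const_mul M) (ae_of_all _ fun x => ?_)
  rw [← mul_sub, norm_mul, Real.norm_eq_abs (b' x - b x)]
  exact mul_le_mul_of_nonneg_right (hM x) (abs_nonneg _)

end LinearFunctionals

/-! ### The spectral form and the laws of linear functionals -/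

section SpectralForm

open ProbabilityTheory

/-- The quadratic form `h ↦ ∫ |∫ exp(iqx) h(x) μ(dx)|² ct(dq)`, written with cosine and sine
transforms. It is the variance of `∫ h b` under a Gaussian measure with spectral measure `ct`. -/
noncomputable def spectralForm (ct μ : Measure ℝ) (h : ℝ → ℝ) : ℝ :=
  ∫ q, ((∫ x, Real.cos (q * x) * h x ∂μ) ^ 2 + (∫ x, Real.sin (q * x) * h x ∂μ) ^ 2) ∂ct

theorem spectralForm_nonneg (ct μ : Measure ℝ) (h : ℝ → ℝ) : 0 ≤ spectralForm ct μ h :=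
  integral_nonneg fun _ => by positivity

theorem spectralForm_const_mul (ct μ : Measure ℝ) (h : ℝ → ℝ) (t : ℝ) :
    spectralForm ct μ (fun x => t * h x) = t ^ 2 * spectralForm ct μ h := by
  simp only [spectralForm, mul_left_comm _ t, integral_const_mul, ← mul_add, mul_pow]

theorem spectralForm_le {ct : Measure ℝ} [IsFiniteMeasure ct] {μ : Measure ℝ} {h : ℝ → ℝ}
    (hh : Integrable h μ) : spectralForm ct μ h ≤ ct.real Set.univ * (2 * (∫ x, |h x| ∂μ) ^ 2) := by
  have hb : ∀ f : ℝ → ℝ, (∀ x, |f x| ≤ 1) → (∫ x, f x * h x ∂μ) ^ 2 ≤ (∫ x, |h x| ∂μ) ^ 2 := by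
    intro f hf
    rw [← sq_abs]
    refine pow_le_pow_left₀ (abs_nonneg _) ?_ 2
    refine norm_integral_le_of_norm_le (f := fun x => f x * h x) hh.abs (ae_of_all _ fun x => ?_)
    rw [norm_mul]
    exact mul_le_of_le_one_left (abs_nonneg _) (hf x)
  calc spectralForm ct μ h ≤ ∫ _, 2 * (∫ x, |h x| ∂μ) ^ 2 ∂ct := by
        refine integral_mono_of_nonneg (ae_of_all _ fun q => by positivity) (integrable_const _)
          (ae_of_all _ fun q => ?_)
        have h1 := hb (fun x => Real.cos (q * x)) fun _ => Real.abs_cos_le_one _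
        have h2 := hb (fun x => Real.sin (q * x)) fun _ => Real.abs_sin_le_one _
        simp only at h1 h2 ⊢
        linarith
    _ = _ := by rw [integral_const, smul_eq_mul]

/-- Bochner's formula turns the covariance form of an integrable function into the spectral form. -/
theorem covariance_eq_spectralForm {ct : Measure ℝ} [IsFiniteMeasure ct] {c : ℝ → ℝ}
    (hc : ∀ x : ℝ, (c x : ℂ) = ∫ q : ℝ, Complex.exp (Complex.I * q * x) ∂ct)
    {η : ℝ → ℝ} (hη : Integrable η) :
    ∫ p : ℝ × ℝ, η p.1 * c (p.1 - p.2) * η p.2 = spectralForm ct volume η := by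
  have hcos : ∀ x, c x = ∫ q, Real.cos (q * x) ∂ct := by
    intro x
    have hint : Integrable (fun q : ℝ => Complex.exp (Complex.I * q * x)) ct := by
      refine Integrable.of_bound (C := 1) (by fun_prop) (ae_of_all _ fun q => ?_)
      rw [mul_assoc, ← Complex.ofReal_mul, Complex.norm_exp_I_mul_ofReal]
    have h1 := congrArg Complex.re (hc x)
    rw [Complex.ofReal_re] at h1
    rw [h1]
    refine (integral_re hint).symm.trans (integral_congr_ae (ae_of_all _ fun q => ?_))
    simp only [RCLike.re_eq_complex_re]
    rw [mul_assoc, mul_comm, ← Complex.ofReal_mul, Complex.exp_ofReal_mul_I_re]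
  have hprod : Integrable (fun p : ℝ × ℝ => η p.1 * η p.2) := hη.mul_prod hη
  calc ∫ p : ℝ × ℝ, η p.1 * c (p.1 - p.2) * η p.2
      = ∫ p : ℝ × ℝ, ∫ q, Real.cos (q * (p.1 - p.2)) * (η p.1 * η p.2) ∂ct := by
        refine integral_congr_ae (ae_of_all _ fun p => ?_)
        simp only
        rw [integral_mul_const, hcos]
        ring
    _ = ∫ q, (∫ p : ℝ × ℝ, Real.cos (q * (p.1 - p.2)) * (η p.1 * η p.2)) ∂ct := by
        refine integral_integral_swap ?_
        have h1 : Integrable (fun z : (ℝ × ℝ) × ℝ => η z.1.1 * η z.1.2)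
            ((volume : Measure (ℝ × ℝ)).prod ct) := hprod.comp_fst ct
        exact h1.bdd_mul (c := 1) (by fun_prop) (ae_of_all _ fun z => Real.abs_cos_le_one _)
    _ = spectralForm ct volume η := by
        refine integral_congr_ae (ae_of_all _ fun q => ?_)
        have hci : Integrable (fun x => Real.cos (q * x) * η x) :=
          hη.bdd_mul (c := 1) (by fun_prop) (ae_of_all _ fun x => Real.abs_cos_le_one _)
        have hsi : Integrable (fun x => Real.sin (q * x) * η x) :=
          hη.bdd_mul (c := 1) (by fun_prop) (ae_of_all _ fun x => Real.abs_sin_le_one _)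
        have hpt : ∀ p : ℝ × ℝ, Real.cos (q * (p.1 - p.2)) * (η p.1 * η p.2) =
            (Real.cos (q * p.1) * η p.1) * (Real.cos (q * p.2) * η p.2) +
            (Real.sin (q * p.1) * η p.1) * (Real.sin (q * p.2) * η p.2) := by
          intro p
          rw [mul_sub, Real.cos_sub]
          ring
        simp only [hpt]
        rw [Measure.volume_eq_prod, integral_add (hci.mul_prod hci) (hsi.mul_prod hsi),
          integral_prod_mul (fun x => Real.cos (q * x) * η x)
            fun x => Real.cos (q * x) * η x, integral_prod_mul (fun x => Real.sin (q * x) * η x)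
            fun x => Real.sin (q * x) * η x]
        ring

/-- The characteristic functional of `P` is Gaussian, with mean `m` and spectral measure `ct`. -/
def HasGaussianCharFunctional (P : Measure Omega) (m : ℝ) (ct : Measure ℝ) : Prop :=
  ∀ η : ℝ → ℝ, ContDiff ℝ ∞ η → HasCompactSupport η →
    charFunctional P η =
      Complex.exp (-Complex.I * m * ((∫ x, η x : ℝ) : ℂ) - 1 / 2 * (spectralForm ct volume η : ℂ))

/-- A linear functional of the field with a smooth test function is a normal random variable. -/
theorem map_integral_mul_eq_gaussianReal {P : Measure Omega} [IsProbabilityMeasure P] {m : ℝ}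
    {ct : Measure ℝ} (hP : HasGaussianCharFunctional P m ct) {η : ℝ → ℝ}
    (hη : ContDiff ℝ ∞ η) (hc : HasCompactSupport η) :
    P.map (fun b : Omega => ∫ x, η x * b x) =
      gaussianReal (m * ∫ x, η x) (spectralForm ct volume η).toNNReal := by
  have hmeas : Measurable fun b : Omega => ∫ x, η x * b x :=
    (continuous_integral_mul hη.continuous hc).measurable
  have : IsProbabilityMeasure (P.map fun b : Omega => ∫ x, η x * b x) :=
    Measure.isProbabilityMeasure_map hmeas.aemeasurable
  refine Measure.ext_of_charFun ?_
  ext t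
  rw [charFun_apply_real, charFun_gaussianReal, integral_map hmeas.aemeasurable (by fun_prop)]
  have h := hP (fun x => -t * η x) (by fun_prop) (hc.mul_left)
  rw [charFunctional, spectralForm_const_mul, integral_const_mul] at h
  rw [Real.coe_toNNReal _ (spectralForm_nonneg _ _ _)]
  convert h using 1
  · refine integral_congr_ae (ae_of_all _ fun b => ?_)
    simp only [mul_assoc, integral_const_mul]
    congr 1
    push_cast
    ring
  · congr 1
    push_cast
    ring

theorem lintegral_sq_integral_mul_eq {P : Measure Omega} [IsProbabilityMeasure P] {m : ℝ}
    {ct : Measure ℝ} (hP : HasGaussianCharFunctional P m ct) {η : ℝ → ℝ}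
    (hη : ContDiff ℝ ∞ η) (hc : HasCompactSupport η) :
    ∫⁻ b : Omega, ‖∫ x, η x * b x‖ₑ ^ 2 ∂P =
      ENNReal.ofReal ((m * ∫ x, η x) ^ 2 + spectralForm ct volume η) := by
  have hmeas : Measurable fun b : Omega => ∫ x, η x * b x :=
    (continuous_integral_mul hη.continuous hc).measurable
  have h1 : ∫⁻ b : Omega, ‖∫ x, η x * b x‖ₑ ^ 2 ∂P =
      ∫⁻ y, ‖y‖ₑ ^ 2 ∂(P.map fun b : Omega => ∫ x, η x * b x) :=
    (lintegral_map (f := fun y : ℝ => ‖y‖ₑ ^ 2) (by fun_prop) hmeas).symm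
  rw [h1, map_integral_mul_eq_gaussianReal hP hη hc]
  set a := m * ∫ x, η x
  set v := (spectralForm ct volume η).toNNReal with hv
  have h2 : Integrable (fun y : ℝ => y ^ 2) (gaussianReal a v) :=
    (memLp_id_gaussianReal 2).integrable_sq
  have h3 : ∫ y, y ^ 2 ∂(gaussianReal a v) = a ^ 2 + v := by
    have h := variance_eq_sub (μ := gaussianReal a v) (memLp_id_gaussianReal 2)
    rw [variance_id_gaussianReal] at h
    simp only [Pi.pow_apply, id, integral_id_gaussianReal] at h
    linarith
  rw [← Real.coe_toNNReal _ (spectralForm_nonneg ct volume η), ← hv, ← h3,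
    ofReal_integral_eq_lintegral_ofReal h2 (ae_of_all _ fun y => sq_nonneg y)]
  refine lintegral_congr fun y => ?_
  rw [← enorm_pow, Real.enorm_of_nonneg (sq_nonneg y)]

end SpectralForm

/-! ### Local square-integrability of the realisations -/

section LocalSquareIntegrability

open Topology Filter

/-- Mollifications of the field have uniformly bounded second moments; by Tonelli's theorem and
Fatou's lemma, used once in space and once over the realisations, so has the field itself. -/
theorem ae_memLp_two_restrict_Ioo {P : Measure Omega} [IsProbabilityMeasure P] {m : ℝ}
    {ct : Measure ℝ} [IsFiniteMeasure ct] (hP : HasGaussianCharFunctional P m ct) (R : ℝ) :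
    ∀ᵐ b : Omega ∂P, MemLp (b : ℝ → ℝ) 2 (volume.restrict (Set.Ioo (-R) R)) := by
  set μ := (volume : Measure ℝ).restrict (Set.Ioo (-R) R) with hμ
  let φ : ℕ → ContDiffBump (0 : ℝ) := fun k =>
    { rIn := 1 / ((k : ℝ) + 1)
      rOut := 2 * (1 / ((k : ℝ) + 1))
      rIn_pos := by positivity
      rIn_lt_rOut := by
        have : 0 < 1 / ((k : ℝ) + 1) := by positivity
        linarith }
  let G : ℕ → ℝ → Omega → ℝ := fun k x b => ∫ t, (φ k).normed volume (x - t) * b t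
  have hsmooth : ∀ k x, ContDiff ℝ ∞ fun t => (φ k).normed volume (x - t) := fun k x =>
    (φ k).contDiff_normed.comp (contDiff_const.sub contDiff_id)
  have hsupp : ∀ k x, HasCompactSupport fun t => (φ k).normed volume (x - t) := fun k x =>
    (φ k).hasCompactSupport_normed.comp_homeomorph (Homeomorph.subLeft x)
  have hconv : ∀ k (b : Omega), (fun x => G k x b) =
      MeasureTheory.convolution ((φ k).normed volume) b (ContinuousLinearMap.lsmul ℝ ℝ) volume := by
    intro k b
    ext x
    rw [convolution_eq_swap]
    rfl
  have hcont : ∀ k (b : Omega), Continuous fun x => G k x b := by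
    intro k b
    rw [hconv]
    exact (φ k).hasCompactSupport_normed.continuous_convolution_left _
      (φ k).continuous_normed b.locInt
  have hmeasb : ∀ k x, Measurable (G k x) := fun k x =>
    (continuous_integral_mul (hsmooth k x).continuous (hsupp k x)).measurable
  have hmeas : ∀ k, Measurable (Function.uncurry (G k)) := fun k =>
    measurable_uncurry_of_continuous_of_measurable (fun b => hcont k b) (hmeasb k)
  set C : ENNReal := ENNReal.ofReal (m ^ 2 + ct.real Set.univ * 2) with hC
  have hbound : ∀ k x, ∫⁻ b, ‖G k x b‖ₑ ^ 2 ∂P ≤ C := by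
    intro k x
    have hint : ∫ t, (φ k).normed volume (x - t) = 1 := by
      rw [integral_sub_left_eq_self (fun t => (φ k).normed volume t) volume x]
      exact (φ k).integral_normed
    have habs : ∫ t, |(φ k).normed volume (x - t)| = 1 := by
      rw [← hint]
      refine integral_congr_ae (ae_of_all _ fun t => ?_)
      exact abs_of_nonneg ((φ k).nonneg_normed _)
    rw [lintegral_sq_integral_mul_eq hP (hsmooth k x) (hsupp k x), hint, mul_one]
    refine ENNReal.ofReal_le_ofReal ?_
    have h := spectralForm_le (ct := ct)
      ((hsmooth k x).continuous.integrable_of_hasCompactSupport (μ := volume) (hsupp k x))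
    rw [habs] at h
    linarith
  have hmeasF : ∀ k, Measurable fun b => ∫⁻ x, ‖G k x b‖ₑ ^ 2 ∂μ := fun k =>
    Measurable.lintegral_prod_left' (f := fun p : ℝ × Omega => ‖G k p.1 p.2‖ₑ ^ 2)
      ((hmeas k).enorm.pow_const 2)
  have hfin : ∫⁻ b, liminf (fun k => ∫⁻ x, ‖G k x b‖ₑ ^ 2 ∂μ) atTop ∂P ≤ C * μ Set.univ := by
    refine (lintegral_liminf_le hmeasF).trans ?_
    refine liminf_le_of_le (by isBoundedDefault) fun a ha => ?_
    obtain ⟨k, hk⟩ := ha.exists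
    refine hk.trans ?_
    rw [lintegral_lintegral_swap (((hmeas k).comp measurable_swap).enorm.pow_const 2).aemeasurable,
      ← lintegral_const]
    exact lintegral_mono fun x => hbound k x
  have hne : ∫⁻ b, liminf (fun k => ∫⁻ x, ‖G k x b‖ₑ ^ 2 ∂μ) atTop ∂P ≠ ⊤ :=
    (hfin.trans_lt (ENNReal.mul_lt_top ENNReal.ofReal_lt_top (measure_lt_top _ _))).ne
  filter_upwards [ae_lt_top (Measurable.liminf hmeasF) hne] with b hb
  have hlim : ∀ᵐ x ∂μ, Tendsto (fun k => G k x b) atTop (𝓝 (b x)) := by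
    refine ae_restrict_of_ae ?_
    have h := ContDiffBump.ae_convolution_tendsto_right_of_locallyIntegrable (μ := volume)
      (φ := φ) (l := atTop) (K := 2) (g := (b : ℝ → ℝ))
      (by
        have := (tendsto_one_div_add_atTop_nhds_zero_nat (𝕜 := ℝ)).const_mul 2
        rwa [mul_zero] at this)
      (Eventually.of_forall fun k => le_rfl) b.locInt
    filter_upwards [h] with x hx
    simpa only [← hconv] using hx
  refine ⟨b.toAEEqFun.aestronglyMeasurable.restrict, ?_⟩
  rw [eLpNorm_lt_top_iff_lintegral_rpow_enorm_lt_top (by norm_num) (by norm_num)]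
  simp only [ENNReal.toReal_ofNat, ENNReal.rpow_ofNat]
  refine lt_of_le_of_lt ?_ hb
  calc ∫⁻ x, ‖b x‖ₑ ^ 2 ∂μ = ∫⁻ x, liminf (fun k => ‖G k x b‖ₑ ^ 2) atTop ∂μ := by
        refine lintegral_congr_ae ?_
        filter_upwards [hlim] with x hx
        exact (((ENNReal.continuous_pow 2).tendsto _).comp hx.enorm).liminf_eq.symm
    _ ≤ _ := lintegral_liminf_le fun k => ((hcont k b).measurable.enorm.pow_const 2)

end LocalSquareIntegrability

/-! ### The law of the field in `L²` of a bounded interval -/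

section WindowLaw

open Topology Filter ProbabilityTheory

/-- Lebesgue measure on the interval `(-R, R)`. -/
noncomputable abbrev window (R : ℝ) : Measure ℝ := volume.restrict (Set.Ioo (-R) R)

/-- `L²(-R, R)` carries its Borel `σ`-algebra. -/
noncomputable instance (R : ℝ) : MeasurableSpace (Lp ℝ 2 (window R)) := borel _

instance (R : ℝ) : BorelSpace (Lp ℝ 2 (window R)) := ⟨rfl⟩

instance (R : ℝ) : SecondCountableTopology (Lp ℝ 2 (window R)) :=
  haveI : Fact ((2 : ENNReal) ≠ ⊤) := ⟨by simp⟩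
  Lp.SecondCountableTopology

/-- The elements of `L²(-R, R)` represented by smooth functions with compact support in
`(-R, R)`. -/
noncomputable def testSubspace (R : ℝ) : Submodule ℝ (Lp ℝ 2 (window R)) where
  carrier := {h | ∃ η : ℝ → ℝ, ContDiff ℝ ∞ η ∧ HasCompactSupport η ∧
    tsupport η ⊆ Set.Ioo (-R) R ∧ h =ᵐ[window R] η}
  zero_mem' := ⟨0, contDiff_const, HasCompactSupport.zero, by simp, Lp.coeFn_zero _ _ _⟩
  add_mem' := by
    rintro h₁ h₂ ⟨η₁, hs₁, hc₁, ht₁, he₁⟩ ⟨η₂, hs₂, hc₂, ht₂, he₂⟩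
    refine ⟨η₁ + η₂, hs₁.add hs₂, hc₁.add hc₂,
      (tsupport_add η₁ η₂).trans (Set.union_subset ht₁ ht₂), ?_⟩
    exact (Lp.coeFn_add h₁ h₂).trans (he₁.add he₂)
  smul_mem' := by
    rintro t h ⟨η, hs, hc, ht, he⟩
    refine ⟨fun x => t * η x, contDiff_const.mul hs, hc.mul_left,
      (tsupport_mul_subset_right (f := fun _ => t) (g := η)).trans ht, ?_⟩
    filter_upwards [Lp.coeFn_smul t h, he] with x hx hηx
    rw [hx, Pi.smul_apply, hηx, smul_eq_mul]

theorem integral_window_mul {R : ℝ} {η : ℝ → ℝ} (ht : tsupport η ⊆ Set.Ioo (-R) R) (f : ℝ → ℝ) :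
    ∫ x, f x * η x ∂(window R) = ∫ x, f x * η x := by
  refine setIntegral_eq_integral_of_forall_compl_eq_zero fun x hx => ?_
  rw [image_eq_zero_of_notMem_tsupport fun h => hx (ht h), mul_zero]

theorem orthogonal_testSubspace (R : ℝ) : (testSubspace R)ᗮ = ⊥ := by
  rw [eq_bot_iff]
  intro f hf
  have hfi : IntegrableOn f (Set.Ioo (-R) R) := (Lp.memLp f).integrable (by norm_num)
  have h0 := isOpen_Ioo.ae_eq_zero_of_integral_contDiff_smul_eq_zero (μ := volume)
    (f := f) hfi.locallyIntegrableOn fun η hs hc ht => by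
      have hη : MemLp η 2 (window R) :=
        (hs.continuous.memLp_of_hasCompactSupport (μ := volume) hc).restrict _
      have horth := (Submodule.mem_orthogonal _ _).1 hf (hη.toLp η)
        ⟨η, hs, hc, ht, hη.coeFn_toLp⟩
      rw [L2.inner_def] at horth
      simp only [smul_eq_mul, mul_comm (η _)]
      rw [← integral_window_mul ht, ← horth]
      refine integral_congr_ae ?_
      filter_upwards [hη.coeFn_toLp] with x hx
      rw [hx]
      simp
  rw [Submodule.mem_bot]
  exact Lp.ext (EventuallyEq.trans ((ae_restrict_iff' measurableSet_Ioo).2 h0)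
    (Lp.coeFn_zero ℝ 2 (window R)).symm)

theorem dense_testSubspace (R : ℝ) : Dense (testSubspace R : Set (Lp ℝ 2 (window R))) := by
  rw [Submodule.dense_iff_topologicalClosure_eq_top, Submodule.topologicalClosure_eq_top_iff]
  exact orthogonal_testSubspace R

open Classical in
/-- The restriction of a realisation to `(-R, R)`, as an element of `L²(-R, R)`; the junk value `0`
is taken where the restriction is not square-integrable. -/
noncomputable def toWindow (R : ℝ) (b : Omega) : Lp ℝ 2 (window R) :=
  if h : MemLp (b : ℝ → ℝ) 2 (window R) then h.toLp b else 0

theorem coeFn_toWindow {R : ℝ} {b : Omega} (h : MemLp (b : ℝ → ℝ) 2 (window R)) :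
    toWindow R b =ᵐ[window R] b := by
  rw [toWindow, dif_pos h]
  exact h.coeFn_toLp

theorem inner_toWindow {R : ℝ} {b : Omega} (hb : MemLp (b : ℝ → ℝ) 2 (window R))
    {h : Lp ℝ 2 (window R)} {η : ℝ → ℝ} (ht : tsupport η ⊆ Set.Ioo (-R) R)
    (he : h =ᵐ[window R] η) : inner ℝ h (toWindow R b) = ∫ x, η x * b x := by
  rw [L2.inner_def]
  simp only [mul_comm (η _)]
  rw [← integral_window_mul ht]
  refine integral_congr_ae ?_
  filter_upwards [he, coeFn_toWindow hb] with x hx hbx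
  rw [hx, hbx]
  simp

/-- The restriction map is measurable because the countably many pairings with a dense sequence of
test functions are, and these embed the Polish space `L²(-R, R)` into a product of lines. -/
theorem aemeasurable_toWindow {P : Measure Omega} {R : ℝ}
    (hP : ∀ᵐ b : Omega ∂P, MemLp (b : ℝ → ℝ) 2 (window R)) : AEMeasurable (toWindow R) P := by
  have : SecondCountableTopology (testSubspace R) :=
    inferInstanceAs (SecondCountableTopology (testSubspace R : Set (Lp ℝ 2 (window R))))
  let d : ℕ → testSubspace R := TopologicalSpace.denseSeq _
  let ι : Lp ℝ 2 (window R) → ℕ → ℝ := fun x k => inner ℝ (d k : Lp ℝ 2 (window R)) x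
  have hcont : Continuous ι := by fun_prop
  have hinj : Function.Injective ι := by
    intro x y hxy
    have hmem : x - y ∈ (testSubspace R)ᗮ := by
      rw [Submodule.mem_orthogonal]
      intro u hu
      have hzero : ∀ v : testSubspace R, inner ℝ (v : Lp ℝ 2 (window R)) (x - y) = 0 := by
        intro v
        induction v using (TopologicalSpace.denseRange_denseSeq (testSubspace R)).induction_on with
        | hp => exact isClosed_eq (by fun_prop) continuous_const
        | ih k =>
          rw [inner_sub_right, sub_eq_zero]
          exact congrFun hxy k
      exact hzero ⟨u, hu⟩
    rw [orthogonal_testSubspace, Submodule.mem_bot, sub_eq_zero] at hmem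
    exact hmem
  rw [← (hcont.measurableEmbedding hinj).aemeasurable_comp_iff, aemeasurable_pi_iff]
  intro k
  obtain ⟨η, hs, hc, ht, he⟩ := (d k).2
  refine ⟨fun b => ∫ x, η x * b x, (continuous_integral_mul hs.continuous hc).measurable, ?_⟩
  filter_upwards [hP] with b hb
  exact inner_toWindow hb ht he

theorem spectralForm_congr_ae {ct μ : Measure ℝ} {f g : ℝ → ℝ} (h : f =ᵐ[μ] g) :
    spectralForm ct μ f = spectralForm ct μ g := by
  have hi : ∀ e : ℝ → ℝ, ∫ x, e x * f x ∂μ = ∫ x, e x * g x ∂μ := fun e =>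
    integral_congr_ae (h.mono fun x hx => by simp only [hx])
  have hc := fun q : ℝ => hi fun x => Real.cos (q * x)
  have hs := fun q : ℝ => hi fun x => Real.sin (q * x)
  simp only [spectralForm, hc, hs]

/-- Integration against a measurable function bounded by `1` is a bounded functional on
`L²(-R, R)`, uniformly in that function. -/
theorem exists_inner_eq_integral_mul (R : ℝ) : ∃ B : ℝ, ∀ f : ℝ → ℝ, Measurable f →
    (∀ x, |f x| ≤ 1) → ∃ e : Lp ℝ 2 (window R), ‖e‖ ≤ B ∧
      ∀ h : Lp ℝ 2 (window R), ∫ x, f x * h x ∂(window R) = inner ℝ e h := by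
  refine ⟨measureUnivNNReal (window R) ^ (2 : ENNReal).toReal⁻¹ * 1, fun f hf hb => ?_⟩
  have hm : MemLp f 2 (window R) := MemLp.of_bound hf.aestronglyMeasurable 1 (ae_of_all _ hb)
  refine ⟨hm.toLp f, Lp.norm_le_of_ae_bound zero_le_one ?_, fun h => ?_⟩
  · filter_upwards [hm.coeFn_toLp] with x hx
    rw [hx]
    exact hb x
  · rw [L2.inner_def]
    refine integral_congr_ae ?_
    filter_upwards [hm.coeFn_toLp] with x hx
    rw [hx]
    simp [mul_comm]

theorem continuous_integral_window (R : ℝ) :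
    Continuous fun h : Lp ℝ 2 (window R) => ∫ x, h x ∂(window R) := by
  obtain ⟨B, hB⟩ := exists_inner_eq_integral_mul R
  obtain ⟨e, -, he⟩ := hB (fun _ => 1) measurable_const (by simp)
  simp only [one_mul] at he
  simp only [he]
  fun_prop

theorem aestronglyMeasurable_spectral_integrand {ct : Measure ℝ} {R : ℝ}
    (h : Lp ℝ 2 (window R)) : AEStronglyMeasurable (fun q =>
      (∫ x, Real.cos (q * x) * h x ∂(window R)) ^ 2 +
        (∫ x, Real.sin (q * x) * h x ∂(window R)) ^ 2) ct := by
  have hh : StronglyMeasurable fun p : ℝ × ℝ => h p.2 :=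
    (Lp.stronglyMeasurable h).comp_measurable measurable_snd
  have hc : StronglyMeasurable fun p : ℝ × ℝ => Real.cos (p.1 * p.2) * h p.2 :=
    (Continuous.stronglyMeasurable (by fun_prop)).mul hh
  have hs : StronglyMeasurable fun p : ℝ × ℝ => Real.sin (p.1 * p.2) * h p.2 :=
    (Continuous.stronglyMeasurable (by fun_prop)).mul hh
  exact ((hc.integral_prod_right'.pow 2).add (hs.integral_prod_right'.pow 2)).aestronglyMeasurable

theorem exists_spectral_integrand_le (R : ℝ) : ∃ B : ℝ, ∀ (q : ℝ) (h : Lp ℝ 2 (window R)),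
    ‖(∫ x, Real.cos (q * x) * h x ∂(window R)) ^ 2 +
      (∫ x, Real.sin (q * x) * h x ∂(window R)) ^ 2‖ ≤ 2 * (B * ‖h‖) ^ 2 := by
  obtain ⟨B, hB⟩ := exists_inner_eq_integral_mul R
  refine ⟨B, fun q h => ?_⟩
  have hle : ∀ f : ℝ → ℝ, Measurable f → (∀ x, |f x| ≤ 1) →
      (∫ x, f x * h x ∂(window R)) ^ 2 ≤ (B * ‖h‖) ^ 2 := by
    intro f hf hf1
    obtain ⟨e, he, hi⟩ := hB f hf hf1
    rw [hi, ← sq_abs]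
    exact pow_le_pow_left₀ (abs_nonneg _) ((abs_real_inner_le_norm e h).trans
      (mul_le_mul_of_nonneg_right he (norm_nonneg _))) 2
  rw [Real.norm_of_nonneg (by positivity)]
  have h1 := hle (fun x => Real.cos (q * x)) (by fun_prop) fun x => Real.abs_cos_le_one _
  have h2 := hle (fun x => Real.sin (q * x)) (by fun_prop) fun x => Real.abs_sin_le_one _
  linarith

theorem continuous_spectralForm (ct : Measure ℝ) [IsFiniteMeasure ct] (R : ℝ) :
    Continuous fun h : Lp ℝ 2 (window R) => spectralForm ct (window R) h := by
  obtain ⟨B, hB⟩ := exists_spectral_integrand_le R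
  obtain ⟨B', hB'⟩ := exists_inner_eq_integral_mul R
  rw [continuous_iff_continuousAt]
  intro h₀
  refine continuousAt_of_dominated (bound := fun _ => 2 * (B * (‖h₀‖ + 1)) ^ 2)
    (Eventually.of_forall aestronglyMeasurable_spectral_integrand) ?_ (integrable_const _)
    (ae_of_all _ fun q => ?_)
  · have hnear : ∀ᶠ h : Lp ℝ 2 (window R) in 𝓝 h₀, ‖h‖ < ‖h₀‖ + 1 :=
      continuous_norm.continuousAt.eventually_lt_const (lt_add_one _)
    filter_upwards [hnear] with h hh
    refine ae_of_all _ fun q => (hB q h).trans ?_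
    rw [mul_pow, mul_pow]
    gcongr
  · obtain ⟨e, -, he⟩ := hB' (fun x => Real.cos (q * x)) (by fun_prop)
      fun x => Real.abs_cos_le_one _
    obtain ⟨f, -, hf⟩ := hB' (fun x => Real.sin (q * x)) (by fun_prop)
      fun x => Real.abs_sin_le_one _
    simp only [he, hf]
    fun_prop

/-- Every non-zero element of `L²(-R, R)` has positive spectral form. -/
theorem spectralForm_ne_zero {ct : Measure ℝ} [IsFiniteMeasure ct] (hatom : ∀ q : ℝ, ct {q} = 0)
    (hpos : 0 < ct Set.univ) {R : ℝ} {h : Lp ℝ 2 (window R)} (hh : h ≠ 0) :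
    spectralForm ct (window R) h ≠ 0 := by
  intro h0
  obtain ⟨B, hB⟩ := exists_spectral_integrand_le R
  have hint : Integrable (fun q => (∫ x, Real.cos (q * x) * h x ∂(window R)) ^ 2 +
      (∫ x, Real.sin (q * x) * h x ∂(window R)) ^ 2) ct :=
    Integrable.of_bound (aestronglyMeasurable_spectral_integrand h) _
      (ae_of_all _ fun q => hB q h)
  have hz := (integral_eq_zero_iff_of_nonneg (fun q => by positivity) hint).1 h0
  refine hh (Lp.ext ((ae_eq_zero_of_cos_sin_integral_eq_zero R hatom hpos
    (Lp.stronglyMeasurable h).measurable ((Lp.memLp h).integrable (by norm_num)) ?_).trans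
    (Lp.coeFn_zero _ _ _).symm))
  filter_upwards [hz] with q hq
  have h1 := sq_nonneg (∫ x, Real.cos (q * x) * h x ∂(window R))
  have h2 := sq_nonneg (∫ x, Real.sin (q * x) * h x ∂(window R))
  simp only [Pi.zero_apply] at hq
  exact ⟨pow_eq_zero_iff two_ne_zero |>.1 (by linarith),
    pow_eq_zero_iff two_ne_zero |>.1 (by linarith)⟩

variable {P : Measure Omega} [IsProbabilityMeasure P] {m : ℝ} {ct : Measure ℝ} [IsFiniteMeasure ct]

/-- The characteristic function of the field restricted to `(-R, R)`: it is given by the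
characteristic functional on test functions, and both sides are continuous on `L²(-R, R)`. -/
theorem charFun_map_toWindow (hP : HasGaussianCharFunctional P m ct) (R : ℝ)
    (h : Lp ℝ 2 (window R)) :
    charFun (P.map (toWindow R)) h =
      Complex.exp (((m * ∫ x, h x ∂(window R) : ℝ) : ℂ) * Complex.I -
        ((spectralForm ct (window R) h : ℝ) : ℂ) / 2) := by
  have hL2 := ae_memLp_two_restrict_Ioo hP R
  have hT := aemeasurable_toWindow hL2
  have : IsProbabilityMeasure (P.map (toWindow R)) := Measure.isProbabilityMeasure_map hT
  have hcharcont : Continuous (charFun (P.map (toWindow R))) := continuous_charFun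
  have hrhs : Continuous fun h : Lp ℝ 2 (window R) =>
      Complex.exp (((m * ∫ x, h x ∂(window R) : ℝ) : ℂ) * Complex.I -
        ((spectralForm ct (window R) h : ℝ) : ℂ) / 2) := by
    have h1 := continuous_integral_window R
    have h2 := continuous_spectralForm ct R
    fun_prop
  refine congrFun (hcharcont.ext_on (dense_testSubspace R) hrhs ?_) h
  rintro h ⟨η, hs, hc, ht, he⟩
  have hmean : ∫ x, h x ∂(window R) = ∫ x, η x := by
    rw [integral_congr_ae he]
    simpa using integral_window_mul ht fun _ => 1
  have hform : spectralForm ct (window R) h = spectralForm ct volume η := by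
    rw [spectralForm_congr_ae he]
    have hc := fun q : ℝ => integral_window_mul ht fun x => Real.cos (q * x)
    have hs := fun q : ℝ => integral_window_mul ht fun x => Real.sin (q * x)
    simp only [spectralForm, hc, hs]
  have hmap := congrArg (fun ρ => charFun ρ 1) (map_integral_mul_eq_gaussianReal hP hs hc)
  rw [charFun_gaussianReal, charFun_apply_real, integral_map
    (continuous_integral_mul hs.continuous hc).aemeasurable (by fun_prop),
    Real.coe_toNNReal _ (spectralForm_nonneg _ _ _)] at hmap
  beta_reduce
  rw [hmean, hform, charFun_apply, integral_map hT (by fun_prop)]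
  have hcongr : ∫ b, Complex.exp ((inner ℝ (toWindow R b) h : ℝ) * Complex.I) ∂P =
      ∫ b : Omega, Complex.exp (((1 : ℝ) : ℂ) * ((∫ x, η x * b x : ℝ) : ℂ) * Complex.I) ∂P := by
    refine integral_congr_ae ?_
    filter_upwards [hL2] with b hb
    rw [real_inner_comm, inner_toWindow hb ht he, Complex.ofReal_one, one_mul]
  rw [hcongr, hmap]
  congr 1
  push_cast
  ring

theorem map_inner_toWindow (hP : HasGaussianCharFunctional P m ct) (R : ℝ)
    (h : Lp ℝ 2 (window R)) :
    (P.map (toWindow R)).map (fun x => inner ℝ h x) =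
      gaussianReal (m * ∫ x, h x ∂(window R)) (spectralForm ct (window R) h).toNNReal := by
  have hT := aemeasurable_toWindow (ae_memLp_two_restrict_Ioo hP R)
  have : IsProbabilityMeasure (P.map (toWindow R)) := Measure.isProbabilityMeasure_map hT
  have hm : Measurable fun x : Lp ℝ 2 (window R) => inner ℝ h x := by fun_prop
  refine Measure.ext_of_charFun ?_
  ext t
  have hchar := charFun_map_toWindow hP R (t • h)
  rw [spectralForm_congr_ae (Lp.coeFn_smul t h), integral_congr_ae (Lp.coeFn_smul t h)] at hchar
  simp only [Pi.smul_apply, smul_eq_mul, integral_const_mul] at hchar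
  change _ = Complex.exp (_ - ((spectralForm ct (window R) (fun x => t * h x) : ℝ) : ℂ) / 2)
    at hchar
  rw [spectralForm_const_mul, charFun_apply] at hchar
  rw [charFun_apply_real, integral_map hm.aemeasurable (by fun_prop), charFun_gaussianReal,
    Real.coe_toNNReal _ (spectralForm_nonneg _ _ _)]
  convert hchar using 1
  · refine integral_congr_ae (ae_of_all _ fun x => ?_)
    simp only
    rw [inner_smul_right, real_inner_comm]
    push_cast
    rfl
  · congr 1
    push_cast
    ring

theorem isGaussian_map_toWindow (hP : HasGaussianCharFunctional P m ct) (R : ℝ) :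
    IsGaussian (P.map (toWindow R)) := by
  refine isGaussian_of_map_eq_gaussianReal fun L => ?_
  obtain ⟨h, rfl⟩ := (InnerProductSpace.toDual ℝ (Lp ℝ 2 (window R))).surjective L
  exact ⟨_, _, map_inner_toWindow hP R h⟩

/-- The field restricted to `(-R, R)` charges every ball of `L²(-R, R)`. -/
theorem measure_window_ball_pos (hP : HasGaussianCharFunctional P m ct)
    (hatom : ∀ q : ℝ, ct {q} = 0) (hpos : 0 < ct Set.univ) {R : ℝ} {b : Omega}
    (hb : MemLp (b : ℝ → ℝ) 2 (window R)) {r : ℝ} (hr : 0 < r) :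
    0 < P {b' : Omega | MemLp (b' : ℝ → ℝ) 2 (window R) ∧
      ∫ x, |b x - b' x| ^ 2 ∂(window R) < r ^ 2} := by
  have hL2 := ae_memLp_two_restrict_Ioo hP R
  have hT := aemeasurable_toWindow hL2
  have := isGaussian_map_toWindow hP R
  have hsupp : (P.map (toWindow R)).support = Set.univ := by
    refine support_eq_univ_of_variance_ne_zero _ fun h hh => ?_
    have hm : Measurable fun x : Lp ℝ 2 (window R) => inner ℝ h x := by fun_prop
    have hvar := variance_map (μ := P.map (toWindow R)) (X := id)
      (Y := fun x : Lp ℝ 2 (window R) => inner ℝ h x) (by fun_prop) hm.aemeasurable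
    rw [map_inner_toWindow hP R h, variance_id_gaussianReal,
      Real.coe_toNNReal _ (spectralForm_nonneg _ _ _)] at hvar
    exact fun h0 => spectralForm_ne_zero hatom hpos hh (hvar.trans h0)
  have hball := (Metric.nhds_basis_ball.mem_measureSupport).1
    (hsupp ▸ Set.mem_univ (toWindow R b)) r hr
  rw [Measure.map_apply_of_aemeasurable hT measurableSet_ball] at hball
  refine hball.trans_le (measure_mono_ae ?_)
  filter_upwards [hL2] with b' hb' hmem
  refine ⟨hb', ?_⟩
  have hdist : ‖toWindow R b - toWindow R b'‖ < r := by
    rw [← dist_eq_norm, dist_comm]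
    exact hmem
  have hnorm : ∫ x, |b x - b' x| ^ 2 ∂(window R) = ‖toWindow R b - toWindow R b'‖ ^ 2 := by
    rw [← real_inner_self_eq_norm_sq, L2.inner_def]
    refine integral_congr_ae ?_
    filter_upwards [Lp.coeFn_sub (toWindow R b) (toWindow R b'), coeFn_toWindow hb,
      coeFn_toWindow hb'] with x hx h1 h2
    rw [hx, Pi.sub_apply, h1, h2, sq_abs, real_inner_self_eq_norm_sq, Real.norm_eq_abs, sq_abs]
  rw [hnorm]
  exact pow_lt_pow_left₀ hdist (norm_nonneg _) two_ne_zero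

end WindowLaw

/-! ### The metric `d₂` and the two supports -/

section Support

open Filter

theorem dTwo_term_nonneg (b b' : Omega) (j : ℤ) : 0 ≤ (2 : ℝ)⁻¹ ^ j.natAbs *
    min 1 (Real.sqrt (∫ x in (j : ℝ)..((j : ℝ) + 1), |b x - b' x| ^ 2)) :=
  mul_nonneg (by positivity) (le_min zero_le_one (Real.sqrt_nonneg _))

theorem dTwo_term_le_weight (b b' : Omega) (j : ℤ) : (2 : ℝ)⁻¹ ^ j.natAbs *
    min 1 (Real.sqrt (∫ x in (j : ℝ)..((j : ℝ) + 1), |b x - b' x| ^ 2)) ≤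
      (2 : ℝ)⁻¹ ^ j.natAbs :=
  mul_le_of_le_one_right (by positivity) (min_le_left _ _)

theorem summable_dTwo (b b' : Omega) : Summable fun j : ℤ => (2 : ℝ)⁻¹ ^ j.natAbs *
    min 1 (Real.sqrt (∫ x in (j : ℝ)..((j : ℝ) + 1), |b x - b' x| ^ 2)) :=
  Summable.of_nonneg_of_le (dTwo_term_nonneg b b') (dTwo_term_le_weight b b') summable_weight

/-- Since intervals of length one have measure one, the `L²_loc` distance dominates the `L¹_loc`
distance. -/
theorem dOne_le_dTwo {b b' : Omega} (hb : b ∈ OmegaTwo) (hb' : b' ∈ OmegaTwo) :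
    dOne b b' ≤ dTwo b b' := by
  refine (summable_dOne b b').tsum_le_tsum (fun j => ?_) (summable_dTwo b b')
  refine mul_le_mul_of_nonneg_left (min_le_min le_rfl ?_) (by positivity)
  refine Real.le_sqrt_of_sq_le ?_
  have hle : (j : ℝ) ≤ j + 1 := by linarith
  rw [intervalIntegral.integral_of_le hle, intervalIntegral.integral_of_le hle]
  have : IsProbabilityMeasure (volume.restrict (Set.Ioc (j : ℝ) (j + 1))) :=
    ⟨by simp⟩
  have hsub : volume.restrict (Set.Ioc (j : ℝ) (j + 1)) ≤
      volume.restrict (Set.Icc (j : ℝ) (j + 1)) :=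
    Measure.restrict_mono Set.Ioc_subset_Icc_self le_rfl
  have hmem : MemLp (fun x => |b x - b' x|) 2 (volume.restrict (Set.Ioc (j : ℝ) (j + 1))) :=
    (((hb _ isCompact_Icc).sub (hb' _ isCompact_Icc)).mono_measure hsub).abs
  -- Non-negativity of the variance of `|b - b'|` on the unit interval is the required inequality.
  have h := ProbabilityTheory.variance_nonneg (fun x => |b x - b' x|)
    (volume.restrict (Set.Ioc (j : ℝ) (j + 1)))
  rw [ProbabilityTheory.variance_eq_sub hmem, sub_nonneg] at h
  exact h

/-- Proximity in `L²(-R, R)` for a large `R` implies proximity in the metric `d₂`. -/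
theorem exists_dTwo_lt (δ : ℝ) (hδ : 0 < δ) : ∃ R r : ℝ, 0 < r ∧ ∀ b b' : Omega,
    MemLp (b : ℝ → ℝ) 2 (window R) → MemLp (b' : ℝ → ℝ) 2 (window R) →
      ∫ x, |b x - b' x| ^ 2 ∂(window R) < r ^ 2 → dTwo b b' < δ := by
  -- Outside a finite set `s` of unit intervals the weights contribute less than `δ / 2`; the window
  -- contains the intervals of `s`, whose total weight is `W`.
  set w : ℤ → ℝ := fun j => (2 : ℝ)⁻¹ ^ j.natAbs with hw
  have hwnn : ∀ j, 0 ≤ w j := fun j => by positivity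
  obtain ⟨s, hs⟩ := ((tendsto_tsum_compl_atTop_zero w).eventually_lt_const
    (half_pos hδ)).exists
  set W := ∑ j ∈ s, w j with hW
  have hWnn : 0 ≤ W := Finset.sum_nonneg fun j _ => hwnn j
  have hr : 0 < δ / (2 * (W + 1)) := by positivity
  refine ⟨∑ j ∈ s, |(j : ℝ)| + 2, δ / (2 * (W + 1)), hr, fun b b' hb hb' hlt => ?_⟩
  set R := ∑ j ∈ s, |(j : ℝ)| + 2 with hR
  set r := δ / (2 * (W + 1)) with hrdef
  have hterm : ∀ j ∈ s, w j *
      min 1 (Real.sqrt (∫ x in (j : ℝ)..((j : ℝ) + 1), |b x - b' x| ^ 2)) ≤ w j * r := by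
    intro j hj
    refine mul_le_mul_of_nonneg_left ((min_le_right _ _).trans ?_) (hwnn j)
    refine Real.sqrt_le_iff.2 ⟨hr.le, le_trans ?_ hlt.le⟩
    rw [intervalIntegral.integral_of_le (by linarith)]
    have hjR : |(j : ℝ)| ≤ R - 2 := by
      rw [hR, add_sub_cancel_right]
      exact Finset.single_le_sum (f := fun j : ℤ => |(j : ℝ)|) (fun i _ => abs_nonneg _) hj
    refine setIntegral_mono_set (hb.sub hb').abs.integrable_sq
      (ae_of_all _ fun x => by positivity) (ae_of_all _ fun x hx => ?_)
    have h1 := abs_le.1 hjR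
    exact ⟨by linarith [hx.1, h1.1], by linarith [hx.2, h1.2]⟩
  have hsum := summable_dTwo b b'
  rw [dTwo, ← hsum.sum_add_tsum_compl (s := s)]
  have h1 : ∑ j ∈ s, w j *
      min 1 (Real.sqrt (∫ x in (j : ℝ)..((j : ℝ) + 1), |b x - b' x| ^ 2)) ≤ δ / 2 := by
    refine (Finset.sum_le_sum hterm).trans ?_
    rw [← Finset.sum_mul, hrdef, ← mul_div_assoc, div_le_iff₀ (by positivity)]
    nlinarith
  have h2 : ∑' j : ↥((s : Set ℤ)ᶜ), (2 : ℝ)⁻¹ ^ (j : ℤ).natAbs *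
      min 1 (Real.sqrt (∫ x in ((j : ℤ) : ℝ)..(((j : ℤ) : ℝ) + 1), |b x - b' x| ^ 2)) ≤
        ∑' j : ↥((s : Set ℤ)ᶜ), w j :=
    Summable.tsum_le_tsum (fun j => dTwo_term_le_weight b b' j)
      (hsum.subtype (s : Set ℤ)ᶜ) (summable_weight.subtype (s : Set ℤ)ᶜ)
  exact (add_lt_add_of_le_of_lt h1 (h2.trans_lt hs)).trans_eq (add_halves δ)

theorem ae_mem_OmegaTwo {P : Measure Omega} [IsProbabilityMeasure P] {m : ℝ} {ct : Measure ℝ}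
    [IsFiniteMeasure ct] (hP : HasGaussianCharFunctional P m ct) : ∀ᵐ b ∂P, b ∈ OmegaTwo := by
  filter_upwards [ae_all_iff.2 fun n : ℕ => ae_memLp_two_restrict_Ioo hP n] with b hb K hK
  obtain ⟨r, hr⟩ := hK.isBounded.subset_closedBall 0
  obtain ⟨n, hn⟩ := exists_nat_gt r
  refine (hb n).mono_measure (Measure.restrict_mono (fun x hx => ?_) le_rfl)
  have h := hr hx
  rw [Metric.mem_closedBall, Real.dist_eq, sub_zero, abs_le] at h
  exact ⟨by linarith, by linarith⟩

theorem OmegaTwo_subset_suppTwo {P : Measure Omega} [IsProbabilityMeasure P] {m : ℝ}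
    {ct : Measure ℝ} [IsFiniteMeasure ct] (hP : HasGaussianCharFunctional P m ct)
    (hatom : ∀ q : ℝ, ct {q} = 0) (hpos : 0 < ct Set.univ) : OmegaTwo ⊆ suppTwo P := by
  refine fun b hb => ⟨hb, fun δ hδ => ?_⟩
  obtain ⟨R, r, hr, h⟩ := exists_dTwo_lt δ hδ
  have hbR : MemLp (b : ℝ → ℝ) 2 (window R) :=
    (hb _ isCompact_Icc).mono_measure (Measure.restrict_mono Set.Ioo_subset_Icc_self le_rfl)
  refine (measure_window_ball_pos hP hatom hpos hbR hr).trans_le (measure_mono_ae ?_)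
  filter_upwards [ae_mem_OmegaTwo hP] with b' hb' hmem
  exact ⟨hb', h b b' hbR hmem.1 hmem.2⟩

theorem suppTwo_subset_suppOne (P : Measure Omega) : suppTwo P ⊆ suppOne P := fun _ hb δ hδ =>
  (hb.2 δ hδ).trans_le (measure_mono fun _ hb' => (dOne_le_dTwo hb.1 hb'.1).trans_lt hb'.2)

end Support

end RUMF

theorem propositionA1 (P : MeasureTheory.Measure RUMF.Omega) (hP : RUMF.IsGaussianRUMF P) :
    RUMF.OmegaTwo = RUMF.suppTwo P ∧ RUMF.OmegaTwo ⊆ RUMF.suppOne P := by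
  obtain ⟨hR, m, c, ct, -, -, hpos, hfin, hatom, hc, hchar⟩ := hP
  have := hR.isProbabilityMeasure
  have : IsFiniteMeasure ct := ⟨hfin⟩
  have hG : RUMF.HasGaussianCharFunctional P m ct := fun η hη hs => by
    rw [hchar η hη hs, RUMF.covariance_eq_spectralForm hc
      (hη.continuous.integrable_of_hasCompactSupport hs)]
  have hsub := RUMF.OmegaTwo_subset_suppTwo hG hatom hpos
  exact ⟨hsub.antisymm fun _ hb => hb.1, hsub.trans (RUMF.suppTwo_subset_suppOne P)⟩
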